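/- Let $n\ge 3$, let $\Omega\subset\mathbb R^n$ be a bounded domain with $0\in\Omega$ (no regularity of $\partial\Omega$ is needed), and let $1<p<1+\frac4n$. Put $$\alpha=\frac{n(p-1)}{2(p+1)},\qquad \gamma=\frac{(1-\alpha)(p+1)}{2-\alpha(p+1)} .$$ Let $H_0^1(\Omega)$ be the closure of $C_c^\infty(\Omega)$ in $H^1(\Omega)$ and write $\|\cdot\|_r$ for the norm of $L^r(\Omega)$. Assume (A): $k\in C^1[0,\infty)$, $k(0)>0$ and $k'(t)\ge 0$ for all $t\ge 0$. Let $u_0\in H_0^1(\Omega)$ be nonnegative and nontrivial, and consider $$\frac{u_t}{|x|^2}-\Delta u=k(t)u^p\ \text{ in }\Omega\times(0,T),\qquad u=0\ \text{ on }\partial\Omega\times(0,T),\qquad u(x,0)=u_0(x)\ \text{ in }\Omega .$$ A weak solution in $\Omega\times(0,T)$ is a function $u\in L^\infty(0,T;H_0^1(\Omega))$ that is absolutely continuous in time with values in $L^2(\Omega)$, with $u(0)=u_0$, $\int_0^T\big\|\frac{u_t(t)}{|x|}\big\|_2^2\,dt<\infty$ and, for almost every $t\in(0,T)$, $$\int_\Omega\frac{u_t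 v}{|x|^2}\,dx+\int_\Omega\nabla u\cdot\nabla v\,dx=k(t)\int_\Omega u^p v\,dx\qquad\text{for all }v\in H_0^1(\Omega),$$ where $u^p$ stands for $|u|^{p-1}u$ (the sign of $u$ is not prescribed). Such a $u$ blows up at the finite time $T^*>0$ if it is a weak solution in $\Omega\times(0,T)$ for every $0<T<T^*$ and $\lim_{t\uparrow T^*}\big\|\frac{u(t)}{|x|}\big\|_2^2=+\infty$. Write $L(t)=\frac12\big\|\frac{u(t)}{|x|}\big\|_2^2$. **Theorem.** One has $\gamma>1$, and there is a constant $G>0$, depending only on $\Omega$, $n$ and $p$, such that $$\|v\|_{p+1}^{p+1}\le G\,\|\nabla v\|_2^{\alpha(p+1)}\|v\|_2^{(1-\alpha)(p+1)}\qquad\text{for all }v\in H_0^1(\Omega).\tag{GN}$$ Let $G>0$ be any constant for which (GN) holds, let $k$ satisfy (A), let $u$ be a weak solution that blows up at $T^*$, and let $k_1\ge k(T^*)$. Put $s=\alpha(p+1)$ and $$C_2=k_1G\,\frac{2-s}{2}\Big(\frac{2}{k_1Gs}\Big)^{-\frac{s}{2-s}},\qquad C^*=2^\gamma(\operatorname{diam}\Omega)^{2\gamma}C_2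 .$$ Then $L(0)>0$, $C^*>0$ and $$T^*\ \ge\ \frac{L(0)^{1-\gamma}}{C^*(\gamma-1)} .$$ -/

import Mathlib

open MeasureTheory Set Filter Topology
open scoped ENNReal ContDiff

noncomputable section

namespace RD

/-- Euclidean space `ℝⁿ`. -/
abbrev E (n : ℕ) : Type := EuclideanSpace ℝ (Fin n)

/-- `L²(Ω)` (real valued). -/
abbrev L2 {n : ℕ} (Ω : Set (E n)) : Type := Lp ℝ 2 (volume.restrict Ω)

/-- `L²(Ω; ℝⁿ)`. -/
abbrev L2vec {n : ℕ} (Ω : Set (E n)) : Type := Lp (E n) 2 (volume.restrict Ω)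

/-- The subspace of `L²(Ω) × L²(Ω; ℝⁿ)` formed by the pairs `(φ, ∇φ)` with `φ ∈ C_c^∞(Ω)`. -/
def testPairs {n : ℕ} (Ω : Set (E n)) : Submodule ℝ (L2 Ω × L2vec Ω) where
  carrier := {q | ∃ φ : E n → ℝ, ContDiff ℝ ∞ φ ∧ HasCompactSupport φ ∧ tsupport φ ⊆ Ω ∧
    (q.1 : E n → ℝ) =ᵐ[volume.restrict Ω] φ ∧
    (q.2 : E n → E n) =ᵐ[volume.restrict Ω] gradient φ}
  zero_mem' := by
    refine ⟨fun _ => 0, contDiff_const, HasCompactSupport.zero, ?_, ?_, ?_⟩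
    · simp [tsupport]
    · exact Lp.coeFn_zero ℝ 2 (volume.restrict Ω)
    · refine (Lp.coeFn_zero (E n) 2 (volume.restrict Ω)).trans ?_
      refine Eventually.of_forall fun x => ?_
      simp [gradient]
  add_mem' := by
    rintro a b ⟨φ, h1, h2, h3, h4, h5⟩ ⟨ψ, g1, g2, g3, g4, g5⟩
    refine ⟨φ + ψ, h1.add g1, h2.add g2, ?_, ?_, ?_⟩
    · exact (tsupport_add φ ψ).trans (union_subset h3 g3)
    · refine (Lp.coeFn_add a.1 b.1).trans ?_
      filter_upwards [h4, g4] with x hx hy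
      simp [hx, hy]
    · refine (Lp.coeFn_add a.2 b.2).trans ?_
      filter_upwards [h5, g5] with x hx hy
      have e1 : DifferentiableAt ℝ φ x := (h1.differentiable (by simp)) x
      have e2 : DifferentiableAt ℝ ψ x := (g1.differentiable (by simp)) x
      simp [hx, hy, gradient, fderiv_add e1 e2]
  smul_mem' := by
    rintro c a ⟨φ, h1, h2, h3, h4, h5⟩
    refine ⟨fun x => c * φ x, contDiff_const.mul h1, h2.mul_left, ?_, ?_, ?_⟩
    · exact (tsupport_mul_subset_right (f := fun _ => c) (g := φ)).trans h3
    · refine (Lp.coeFn_smul c a.1).trans ?_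
      filter_upwards [h4] with x hx
      simp [hx]
    · refine (Lp.coeFn_smul c a.2).trans ?_
      filter_upwards [h5] with x hx
      have e1 : DifferentiableAt ℝ φ x := (h1.differentiable (by simp)) x
      simp [hx, gradient, fderiv_const_mul e1 c]

/-- The Sobolev space `H_0^1(Ω)`: the closure of `C_c^∞(Ω)` for the `H^1` norm. An element is
stored as the pair (function, weak gradient); the second component is determined by the first. -/
def H10 {n : ℕ} (Ω : Set (E n)) : Submodule ℝ (L2 Ω × L2vec Ω) :=
  (testPairs Ω).topologicalClosure

/-- The function underlying an element of `H_0^1(Ω)`. -/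
def toL2 {n : ℕ} {Ω : Set (E n)} (v : H10 Ω) : L2 Ω := v.1.1

/-- The weak gradient of an element of `H_0^1(Ω)`. -/
def grad {n : ℕ} {Ω : Set (E n)} (v : H10 Ω) : L2vec Ω := v.1.2

/-- `½ ‖v/|x|‖₂²`; for a solution `u` the function of time `L(t)` is `halfHardy (u t)`. -/
def halfHardy {n : ℕ} {Ω : Set (E n)} (v : H10 Ω) : ℝ :=
  (1 / 2) * ∫ x in Ω, (toL2 v x) ^ 2 / ‖x‖ ^ 2

/-- Assumption (A): `k ∈ C¹[0,∞)`, `k(0) > 0`, `k' ≥ 0` on `[0,∞)`. -/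
structure AssumptionA (k : ℝ → ℝ) : Prop where
  contDiffOn : ContDiffOn ℝ 1 k (Ici 0)
  pos : 0 < k 0
  deriv_nonneg : ∀ t ∈ Ici (0 : ℝ), 0 ≤ derivWithin k (Ici 0) t

/-- Weak solutions on `Ω × (0,T)` of `u_t/|x|² - Δu = k(t) u^p`, `u = 0` on `∂Ω`, `u(0) = u₀`:
`u ∈ L^∞(0,T; H_0^1(Ω))`, `u` is an absolutely continuous `L²(Ω)`-valued function of time with
`u(0) = u₀` whose time derivative `w = u_t` satisfies `∫_0^T ‖u_t/|x|‖₂² dt < ∞`, and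
`(u_t/|x|², v) + (∇u, ∇v) = k(t) (u^p, v)` for almost every `t ∈ (0,T)` and all `v ∈ H_0^1(Ω)`.
The power is written `|u|^(p-1) u`, which is `u^p` for `u ≥ 0`; no sign of `u` is presupposed. -/
def IsWeakSolution {n : ℕ} (Ω : Set (E n)) (p : ℝ) (k : ℝ → ℝ) (u₀ : H10 Ω) (T : ℝ)
    (u : ℝ → H10 Ω) : Prop :=
  MemLp u ⊤ (volume.restrict (Ioo 0 T)) ∧
  u 0 = u₀ ∧
  ∃ w : ℝ → L2 Ω,
    AEStronglyMeasurable w (volume.restrict (Ioo 0 T)) ∧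
    (∫⁻ t in Ioo 0 T, ∫⁻ x in Ω, ‖w t x / ‖x‖‖ₑ ^ 2) < ⊤ ∧
    (∀ t ∈ Ico 0 T, toL2 (u t) = toL2 u₀ + ∫ s in (0 : ℝ)..t, w s) ∧
    ∀ᵐ t ∂(volume.restrict (Ioo 0 T)), ∀ v : H10 Ω,
      (∫ x in Ω, w t x / ‖x‖ ^ 2 * toL2 v x) + (∫ x in Ω, inner ℝ (grad (u t) x) (grad v x)) =
        k t * ∫ x in Ω, |toL2 (u t) x| ^ (p - 1) * toL2 (u t) x * toL2 v x

/-- `u` is a weak solution on `[0,T₀)`, that is, on `Ω × (0,T)` for every `T < T₀`, and it blows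
up at the finite time `T₀`: `‖u(t)/|x|‖₂² → +∞` as `t → T₀`. -/
def BlowsUpAt {n : ℕ} (Ω : Set (E n)) (p : ℝ) (k : ℝ → ℝ) (u₀ : H10 Ω) (T₀ : ℝ)
    (u : ℝ → H10 Ω) : Prop :=
  0 < T₀ ∧ (∀ T ∈ Ioo 0 T₀, IsWeakSolution Ω p k u₀ T u) ∧
  Tendsto (fun t => ∫ x in Ω, (toL2 (u t) x) ^ 2 / ‖x‖ ^ 2) (𝓝[<] T₀) atTop

/-- `α = n(p-1)/(2(p+1))`. -/
def alphaExp (n : ℕ) (p : ℝ) : ℝ := n * (p - 1) / (2 * (p + 1))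

/-- `γ = (1-α)(p+1)/(2-α(p+1))`. -/
def gammaExp (n : ℕ) (p : ℝ) : ℝ :=
  (1 - alphaExp n p) * (p + 1) / (2 - alphaExp n p * (p + 1))

/-- `G` is an admissible constant in the Gagliardo–Nirenberg inequality
`‖v‖_{p+1}^{p+1} ≤ G ‖∇v‖₂^{α(p+1)} ‖v‖₂^{(1-α)(p+1)}` on `H_0^1(Ω)`. -/
def IsGNConstant {n : ℕ} (Ω : Set (E n)) (p G : ℝ) : Prop :=
  0 < G ∧ ∀ v : H10 Ω, ∫⁻ x in Ω, ‖toL2 v x‖ₑ ^ (p + 1) ≤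
    ENNReal.ofReal (G * ‖grad v‖ ^ (alphaExp n p * (p + 1)) *
      ‖toL2 v‖ ^ ((1 - alphaExp n p) * (p + 1)))

/-- `C₂ = k₁ G (2-s)/2 · ε^(-s/(2-s))` with `s = α(p+1)` and `ε = 2/(k₁ G s)`. -/
def Ctwo (n : ℕ) (p k₁ G : ℝ) : ℝ :=
  let s := alphaExp n p * (p + 1)
  k₁ * G * ((2 - s) / 2) * (2 / (k₁ * G * s)) ^ (-(s / (2 - s)))

/-- `C^* = 2^γ diam(Ω)^{2γ} C₂`. -/
def Cstar {n : ℕ} (Ω : Set (E n)) (p k₁ G : ℝ) : ℝ :=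
  2 ^ gammaExp n p * Metric.diam Ω ^ (2 * gammaExp n p) * Ctwo n p k₁ G

end RD

end

namespace RD

/-! Testing the equation with `u` itself gives `L' = k ‖u‖_{p+1}^{p+1} - ‖∇u‖₂²`. Write `s =
α(p+1)`. By (GN) the source is at most `k₁ G ‖∇u‖₂^s ‖u‖₂^{p+1-s}`, and `p < 1 + 4/n` says exactly
that `s < 2`. Young's inequality (`mul_rpow_mul_le_sq_add`) therefore absorbs the gradient factor
into `‖∇u‖₂²` and leaves `C₂ ‖u‖₂^{2γ}`. Since `|x| ≤ diam Ω` on `Ω`, `‖u‖₂ ≤ diam Ω · ‖u/|x|‖₂`,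
hence `L' ≤ C^* L^γ` (`source_sub_dirichlet_le`). Integration bounds `L(t)^{1-γ}` below by
`L(0)^{1-γ} - C^*(γ-1)t` (`rpow_sub_le_rpow_of_le_integral`). As `γ > 1`, blow-up sends `L(t)^{1-γ}`
to `0`, which is the claim.

The delicate point is that `L` is absolutely continuous. `exists_integrable_weighted` makes
`u_t/|x|` a Bochner integrable `L²`-valued function, so `u/|x|` is a primitive as soon as it lies in
`L²` at one time (`IsWeakSolution.exists_primitive`). Blow-up supplies such a time, so Hardy's
inequality is not needed. The formula for `L'` is then the energy identity `half_norm_sq_primitive`.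

Existence of `G` is independent of this: Sobolev embedding and interpolation on test functions, then
Fatou on the closure. -/

/-! ### Exponents and constants. -/

theorem sobolevExp_eq {n : ℕ} {p : ℝ} (hp : 1 < p) :
    alphaExp n p * (p + 1) = n * (p - 1) / 2 := by
  unfold alphaExp
  have : p + 1 ≠ 0 := by linarith
  field_simp

theorem sobolevExp_pos {n : ℕ} (hn : 3 ≤ n) {p : ℝ} (hp : 1 < p) :
    0 < alphaExp n p * (p + 1) := by
  rw [sobolevExp_eq hp]
  have : (0 : ℝ) < n := by positivity
  have : 0 < p - 1 := by linarith
  positivity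

theorem sobolevExp_lt_two {n : ℕ} (hn : 3 ≤ n) {p : ℝ} (hp : 1 < p) (hp' : p < 1 + 4 / (n : ℝ)) :
    alphaExp n p * (p + 1) < 2 := by
  rw [sobolevExp_eq hp]
  have hn' : (0 : ℝ) < n := by positivity
  have : (p - 1) < 4 / n := by linarith
  rw [lt_div_iff₀ hn'] at this
  linarith

/-- Numerator minus denominator is `p - 1`, and the denominator `2 - s` is positive. -/
theorem one_lt_gammaExp {n : ℕ} (hn : 3 ≤ n) {p : ℝ} (hp : 1 < p) (hp' : p < 1 + 4 / (n : ℝ)) :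
    1 < gammaExp n p := by
  have h := sobolevExp_lt_two hn hp hp'
  unfold gammaExp
  rw [one_lt_div (by linarith)]
  linarith

theorem Ctwo_pos {n : ℕ} (hn : 3 ≤ n) {p : ℝ} (hp : 1 < p) (hp' : p < 1 + 4 / (n : ℝ))
    {k₁ G : ℝ} (hk : 0 < k₁) (hG : 0 < G) : 0 < Ctwo n p k₁ G := by
  have h := sobolevExp_lt_two hn hp hp'
  have h0 := sobolevExp_pos hn hp
  have h2 : 0 < 2 - alphaExp n p * (p + 1) := by linarith
  simp only [Ctwo]
  positivity

/-! ### Young's inequality and the nonlinear Gronwall inequality. -/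

/-- Young's inequality absorbing `a ^ s`, `s < 2`, into `a ^ 2` with the optimal constant. -/
theorem mul_rpow_mul_le_sq_add {K s a b : ℝ} (hK : 0 < K) (hs : 0 < s) (hs2 : s < 2)
    (ha : 0 ≤ a) (hb : 0 ≤ b) :
    K * a ^ s * b ≤
      a ^ 2 + K * ((2 - s) / 2) * (2 / (K * s)) ^ (-(s / (2 - s))) * b ^ (2 / (2 - s)) := by
  have h2 : 0 < 2 - s := by linarith
  -- Weighted AM-GM with weights `s/2` and `(2-s)/2` is applied to `(2/s) a²` and `y`: the weighted
  -- sum is the right-hand side, and in the product the constants cancel to `K a^s b`.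
  set y := K * (2 / (K * s)) ^ (-(s / (2 - s))) * b ^ (2 / (2 - s)) with hy
  have hε : 0 < 2 / (K * s) := by positivity
  have key := Real.geom_mean_le_arith_mean2_weighted (w₁ := s / 2) (w₂ := (2 - s) / 2)
    (p₁ := (2 / s) * a ^ 2) (p₂ := y) (by positivity) (by positivity) (by positivity)
    (by positivity) (by ring)
  have e1 : ((2 / s) * a ^ 2) ^ (s / 2) = (2 / s) ^ (s / 2) * a ^ s := by
    rw [Real.mul_rpow (by positivity) (by positivity), ← Real.rpow_natCast a 2,
      ← Real.rpow_mul ha]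
    congr 2
    push_cast
    ring
  have e2 : y ^ ((2 - s) / 2) = K ^ ((2 - s) / 2) * (2 / (K * s)) ^ (-(s / 2)) * b := by
    rw [hy, Real.mul_rpow (by positivity) (by positivity),
      Real.mul_rpow (by positivity) (by positivity), ← Real.rpow_mul hε.le, ← Real.rpow_mul hb]
    have t1 : -(s / (2 - s)) * ((2 - s) / 2) = -(s / 2) := by field_simp
    have t2 : 2 / (2 - s) * ((2 - s) / 2) = 1 := by field_simp
    rw [t1, t2, Real.rpow_one]
  have e3 : (2 / s) ^ (s / 2) * a ^ s * (K ^ ((2 - s) / 2) * (2 / (K * s)) ^ (-(s / 2)) * b) =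
      K * a ^ s * b := by
    have t : (2 / s : ℝ) = 2 / (K * s) * K := by field_simp
    rw [t, Real.mul_rpow hε.le hK.le, Real.rpow_neg hε.le]
    have u1 : (2 / (K * s)) ^ (s / 2) ≠ 0 := (Real.rpow_pos_of_pos hε _).ne'
    have u2 : K ^ (s / 2) * K ^ ((2 - s) / 2) = K := by
      rw [← Real.rpow_add hK]
      have : s / 2 + (2 - s) / 2 = 1 := by ring
      rw [this, Real.rpow_one]
    calc _ = ((2 / (K * s)) ^ (s / 2) * ((2 / (K * s)) ^ (s / 2))⁻¹) *
          (K ^ (s / 2) * K ^ ((2 - s) / 2)) * a ^ s * b := by ring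
      _ = _ := by rw [mul_inv_cancel₀ u1, u2, one_mul]
  rw [e1, e2, e3] at key
  refine key.trans (le_of_eq ?_)
  rw [hy]
  field_simp

/-- A nonlinear Gronwall inequality: a lower bound for the blow-up time of `f' ≤ C f ^ γ`. -/
theorem rpow_sub_le_rpow_of_le_integral {f : ℝ → ℝ} {C γ T : ℝ} (hf : Continuous f)
    (hf0 : ∀ t, 0 ≤ f t) (h0 : 0 < f 0) (hC : 0 ≤ C) (hγ : 1 < γ)
    (h : ∀ t ∈ Icc 0 T, f t ≤ f 0 + ∫ s in (0 : ℝ)..t, C * f s ^ γ)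
    {t : ℝ} (ht : t ∈ Icc 0 T) (hpos : 0 < f t) :
    f 0 ^ (1 - γ) - C * (γ - 1) * t ≤ f t ^ (1 - γ) := by
  -- Differentiability of `f` is not available, so the argument runs on the majorant `F ≥ f`, which
  -- satisfies `F' = C f^γ ≤ C F^γ`.
  set F : ℝ → ℝ := fun t => f 0 + ∫ s in (0 : ℝ)..t, C * f s ^ γ with hF
  have hc : Continuous fun s => C * f s ^ γ :=
    continuous_const.mul (hf.rpow_const fun x => Or.inr (by linarith))
  have hd : ∀ x, HasDerivAt F (C * f x ^ γ) x := fun x =>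
    (intervalIntegral.integral_hasDerivAt_right (hc.intervalIntegrable _ _)
      (hc.stronglyMeasurableAtFilter _ _) hc.continuousAt).const_add _
  have hFpos : ∀ x ∈ Icc 0 T, 0 < F x := fun x hx => by
    have : 0 ≤ ∫ s in (0 : ℝ)..x, C * f s ^ γ :=
      intervalIntegral.integral_nonneg hx.1 fun u _ => mul_nonneg hC (Real.rpow_nonneg (hf0 u) _)
    simp only [hF]; linarith
  have hd2 : ∀ x ∈ Icc 0 T, HasDerivAt (fun t => F t ^ (1 - γ) + C * (γ - 1) * t)
      ((C * f x ^ γ) * (1 - γ) * F x ^ (1 - γ - 1) + C * (γ - 1)) x := fun x hx => by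
    refine ((hd x).rpow_const (Or.inl (hFpos x hx).ne')).add ?_
    simpa using (hasDerivAt_id x).const_mul (C * (γ - 1))
  have hmono : MonotoneOn (fun t => F t ^ (1 - γ) + C * (γ - 1) * t) (Icc 0 T) := by
    refine monotoneOn_of_deriv_nonneg (convex_Icc _ _)
      (fun x hx => (hd2 x hx).continuousAt.continuousWithinAt)
      (fun x hx => (hd2 x (interior_subset hx)).differentiableAt.differentiableWithinAt)
      fun x hx => ?_
    have hx := interior_subset hx
    rw [(hd2 x hx).deriv]
    have h1 : f x ^ γ * F x ^ (1 - γ - 1) ≤ 1 := by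
      have : (1 - γ - 1) = -γ := by ring
      rw [this, Real.rpow_neg (hFpos x hx).le, ← div_eq_mul_inv,
        div_le_one (Real.rpow_pos_of_pos (hFpos x hx) _)]
      exact Real.rpow_le_rpow (hf0 x) (h x hx) (by linarith)
    have h2 : 0 ≤ C * (γ - 1) * (1 - f x ^ γ * F x ^ (1 - γ - 1)) :=
      mul_nonneg (mul_nonneg hC (by linarith)) (by linarith)
    linarith
  have h3 := hmono (left_mem_Icc.2 (ht.1.trans ht.2)) ht ht.1
  have hF0 : F 0 = f 0 := by simp [hF]
  simp only [hF0, mul_zero, add_zero] at h3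
  -- The exponent `1 - γ` is negative, so `f t ≤ F t` is reversed.
  have h4 : F t ^ (1 - γ) ≤ f t ^ (1 - γ) :=
    Real.rpow_le_rpow_of_nonpos hpos (h t ht) (by linarith)
  linarith

/-! ### Energy identity for Hilbert-space-valued primitives. -/

/-- Domination of increments passes to the sums over disjoint intervals. It serves to compare
`½‖U‖²` with the scalar primitive of `M‖W‖`. -/
theorem _root_.AbsolutelyContinuousOnInterval.of_dist_le {X Y : Type*} [PseudoMetricSpace X]
    [PseudoMetricSpace Y] {f : ℝ → X} {g : ℝ → Y} {a b : ℝ}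
    (hg : AbsolutelyContinuousOnInterval g a b)
    (h : ∀ x ∈ uIcc a b, ∀ y ∈ uIcc a b, dist (f x) (f y) ≤ dist (g x) (g y)) :
    AbsolutelyContinuousOnInterval f a b := by
  refine tendsto_of_tendsto_of_tendsto_of_le_of_le' tendsto_const_nhds hg
    (Eventually.of_forall fun E => Finset.sum_nonneg fun _ _ => dist_nonneg) ?_
  refine eventually_inf_principal.2 (Eventually.of_forall fun E hE => Finset.sum_le_sum ?_)
  intro i hi
  exact h _ (hE.1 i hi).1 _ (hE.1 i hi).2

variable {H : Type*} [NormedAddCommGroup H] [InnerProductSpace ℝ H] [CompleteSpace H]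

/-- The energy identity `½‖U‖²(t) = ½‖U‖²(0) + ∫ ⟪U, U'⟫` for a primitive `U`. -/
theorem half_norm_sq_primitive {W : ℝ → H} (hW : Integrable W) (U₀ : H) (t : ℝ) :
    let U : ℝ → H := fun t => U₀ + ∫ s in (0 : ℝ)..t, W s
    IntervalIntegrable (fun s => inner ℝ (U s) (W s)) volume 0 t ∧
    1 / 2 * ‖U t‖ ^ 2 = 1 / 2 * ‖U 0‖ ^ 2 + ∫ s in (0 : ℝ)..t, inner ℝ (U s) (W s) := by
  intro U
  have hUc : Continuous U := continuous_const.add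
    (intervalIntegral.continuous_primitive (fun a b => hW.intervalIntegrable) 0)
  obtain ⟨M, hM⟩ : ∃ M, ∀ x ∈ uIcc 0 t, ‖U x‖ ≤ M :=
    isCompact_uIcc.exists_bound_of_continuousOn hUc.continuousOn
  have hM0 : 0 ≤ M := (norm_nonneg _).trans (hM 0 left_mem_uIcc)
  have hI : IntervalIntegrable (fun s => M * ‖W s‖) volume 0 t :=
    (hW.norm.const_mul M).intervalIntegrable
  have hg := hI.absolutelyContinuousOnInterval_intervalIntegral (c := 0) left_mem_uIcc
  have hsub : ∀ x y, U x - U y = ∫ s in y..x, W s := fun x y => by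
    simp only [U, add_sub_add_left_eq_sub]
    exact intervalIntegral.integral_interval_sub_left hW.intervalIntegrable hW.intervalIntegrable
  -- Factoring the difference of squares, with `‖U‖ ≤ M` on the interval, bounds an increment of
  -- `½‖U‖²` by that of `∫ M‖W‖`.
  have hAC : AbsolutelyContinuousOnInterval (fun x => 1 / 2 * ‖U x‖ ^ 2) 0 t := by
    refine hg.of_dist_le fun x hx y hy => ?_
    have e : (∫ s in (0 : ℝ)..x, M * ‖W s‖) - (∫ s in (0 : ℝ)..y, M * ‖W s‖) =
        M * ∫ s in y..x, ‖W s‖ := by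
      rw [intervalIntegral.integral_interval_sub_left (hW.norm.const_mul M).intervalIntegrable
        (hW.norm.const_mul M).intervalIntegrable, intervalIntegral.integral_const_mul]
    rw [Real.dist_eq, Real.dist_eq, e, abs_mul, abs_of_nonneg hM0]
    have h1 : |‖U x‖ - ‖U y‖| ≤ |∫ s in y..x, ‖W s‖| :=
      (abs_norm_sub_norm_le _ _).trans
        ((hsub x y ▸ intervalIntegral.norm_integral_le_abs_integral_norm))
    have h2 : |1 / 2 * (‖U x‖ + ‖U y‖)| ≤ M := by
      rw [abs_of_nonneg (by positivity)]
      linarith [hM x hx, hM y hy]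
    calc |1 / 2 * ‖U x‖ ^ 2 - 1 / 2 * ‖U y‖ ^ 2|
        = |1 / 2 * (‖U x‖ + ‖U y‖)| * |‖U x‖ - ‖U y‖| := by rw [← abs_mul]; congr 1; ring
      _ ≤ _ := mul_le_mul h2 h1 (abs_nonneg _) hM0
  have hder : ∀ᵐ x, x ∈ uIcc 0 t →
      deriv (fun x => 1 / 2 * ‖U x‖ ^ 2) x = inner ℝ (U x) (W x) := by
    filter_upwards [(hW.intervalIntegrable (a := 0) (b := t)).ae_hasDerivAt_integral] with x hx hxt
    have h1 : HasDerivAt U (W x) x := (hx hxt 0 left_mem_uIcc).const_add _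
    rw [(h1.norm_sq.const_mul (1 / 2 : ℝ)).deriv]
    ring
  have hder' : ∀ᵐ x, x ∈ uIoc 0 t →
      deriv (fun x => 1 / 2 * ‖U x‖ ^ 2) x = inner ℝ (U x) (W x) := by
    filter_upwards [hder] with x hx hxt using hx (uIoc_subset_uIcc hxt)
  constructor
  · exact hAC.intervalIntegrable_deriv.congr_ae
      ((ae_restrict_iff' measurableSet_uIoc).2 hder')
  · have := hAC.integral_deriv_eq_sub
    rw [intervalIntegral.integral_congr_ae hder'] at this
    linarith

/-! ### The Gagliardo–Nirenberg inequality. -/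

theorem _root_.enorm_gradient {F : Type*} [NormedAddCommGroup F] [InnerProductSpace ℝ F]
    [CompleteSpace F] (φ : F → ℝ) (x : F) : ‖gradient φ x‖ₑ = ‖fderiv ℝ φ x‖ₑ := by
  simp only [gradient, LinearIsometryEquiv.enorm_map]

/-- Lebesgue interpolation between exponents `2` and `r`. -/
theorem lintegral_enorm_rpow_le_interpolation {X : Type*} [MeasurableSpace X] {μ : Measure X}
    {φ : X → ℝ} (hφ : AEStronglyMeasurable φ μ) {a b r q : ℝ} (ha : 0 ≤ a) (hb : 0 ≤ b)
    (hab : a + b = 1) (hr : 0 ≤ r) (hq : 2 * a + r * b = q) :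
    ∫⁻ x, ‖φ x‖ₑ ^ q ∂μ ≤ (∫⁻ x, ‖φ x‖ₑ ^ (2 : ℝ) ∂μ) ^ a * (∫⁻ x, ‖φ x‖ₑ ^ r ∂μ) ^ b := by
  refine le_trans (le_of_eq ?_) (ENNReal.lintegral_mul_norm_pow_le
    (hφ.enorm.pow_const _) (hφ.enorm.pow_const _) ha hb hab)
  refine lintegral_congr fun x => ?_
  rw [← ENNReal.rpow_mul, ← ENNReal.rpow_mul, ← hq, ENNReal.rpow_add_of_nonneg] <;> positivity

/-- The Gagliardo–Nirenberg inequality for test functions. -/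
theorem exists_lintegral_testFunction_le {n : ℕ} (hn : 3 ≤ n) {p : ℝ} (hp : 1 < p)
    (hp' : p < 1 + 4 / (n : ℝ)) :
    ∃ C : NNReal, ∀ φ : E n → ℝ, ContDiff ℝ ∞ φ → HasCompactSupport φ →
      ∫⁻ x, ‖φ x‖ₑ ^ (p + 1) ≤
        (C * eLpNorm (fderiv ℝ φ) 2 volume) ^ (alphaExp n p * (p + 1)) *
          eLpNorm φ 2 volume ^ ((1 - alphaExp n p) * (p + 1)) := by
  have hn3 : (3 : ℝ) ≤ n := by exact_mod_cast hn
  have hn2 : 0 < (n : ℝ) - 2 := by linarith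
  -- The critical Sobolev exponent `2^* = 2n/(n-2)`.
  set r : NNReal := ⟨2 * n / (n - 2), by positivity⟩ with hr
  have hrr : (r : ℝ) = 2 * n / (n - 2) := rfl
  have hr0 : (r : ℝ) ≠ 0 := by rw [hrr]; positivity
  have hrpos : 0 < (r : ℝ) := by rw [hrr]; positivity
  refine ⟨SNormLESNormFDerivOfEqConst ℝ (volume : Measure (E n)) (2 : NNReal), fun φ h1 h2 => ?_⟩
  have hS := eLpNorm_le_eLpNorm_fderiv_of_eq (F := ℝ) (volume : Measure (E n)) (u := φ)
    (p := 2) (p' := r) (h1.of_le (by exact_mod_cast le_top)) h2 (by norm_num)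
    (by simp only [finrank_euclideanSpace_fin]; omega)
    (by
      rw [hrr, finrank_euclideanSpace_fin]
      push_cast
      field_simp)
  have hs2 := sobolevExp_lt_two hn hp hp'
  have hs0 := sobolevExp_pos hn hp
  set s := alphaExp n p * (p + 1) with hs
  have hsv : s = n * (p - 1) / 2 := sobolevExp_eq hp
  have hb : (n : ℝ) * (p - 1) < 4 := by linarith
  have hp1 : 0 < p - 1 := by linarith
  -- The interpolation weight solving `2(1-b) + r b = p + 1`; it also gives `r b = s`, and `b ≤ 1`
  -- follows from `n(p-1) < 4`.
  set b := (p - 1) * (n - 2) / 4 with hbdef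
  have hrb : (r : ℝ) * b = s := by rw [hrr, hsv, hbdef]; field_simp; norm_num
  have e2 : (1 - alphaExp n p) * (p + 1) = 2 * (1 - b) := by
    have : (1 - alphaExp n p) * (p + 1) = p + 1 - s := by rw [hs]; ring
    rw [this, hsv, hbdef]; ring
  have hb1 : 0 ≤ 1 - b := by rw [hbdef]; linarith
  have hI := lintegral_enorm_rpow_le_interpolation (μ := (volume : Measure (E n)))
    h1.continuous.aestronglyMeasurable hb1 (b := b) (by positivity) (by ring) hrpos.le
    (q := p + 1) (by rw [hrb, hsv, hbdef]; ring)
  refine hI.trans ?_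
  rw [mul_comm]
  refine mul_le_mul' ?_ ?_
  · have h3 : (∫⁻ x, ‖φ x‖ₑ ^ (r : ℝ)) ^ b = (eLpNorm φ r volume) ^ s := by
      rw [eLpNorm_nnreal_eq_lintegral (by exact_mod_cast hr0), ← ENNReal.rpow_mul]
      congr 1
      rw [← hrb]
      field_simp
    rw [h3]
    exact ENNReal.rpow_le_rpow hS hs0.le
  · have h3 : eLpNorm φ 2 (volume : Measure (E n)) = (∫⁻ x, ‖φ x‖ₑ ^ (2 : ℝ)) ^ (1 / 2 : ℝ) := by
      have := eLpNorm_nnreal_eq_lintegral (p := 2) (f := φ) (μ := (volume : Measure (E n)))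
        (by norm_num)
      simpa using this
    rw [h3, ← ENNReal.rpow_mul, e2]
    refine le_of_eq ?_
    congr 1
    ring

/-- Both norms on the right are continuous in the `H¹` topology, while the left side is lower
semicontinuous by Fatou, so the bound passes from test functions to the closure. No regularity of
`Ω` enters, because test functions extend by zero to the whole space. -/
theorem exists_isGNConstant {n : ℕ} (hn : 3 ≤ n) (Ω : Set (E n)) {p : ℝ} (hp : 1 < p)
    (hp' : p < 1 + 4 / (n : ℝ)) : ∃ G : ℝ, IsGNConstant Ω p G := by
  obtain ⟨C, hC⟩ := exists_lintegral_testFunction_le hn hp hp'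
  have hs2 := sobolevExp_lt_two hn hp hp'
  have hs0 := sobolevExp_pos hn hp
  have e2 : (1 - alphaExp n p) * (p + 1) = p + 1 - alphaExp n p * (p + 1) := by ring
  set s := alphaExp n p * (p + 1) with hs
  have hq0 : 0 < (1 - alphaExp n p) * (p + 1) := by rw [e2]; linarith
  set q := (1 - alphaExp n p) * (p + 1) with hq
  -- The added `1` guarantees `G > 0` even if the Sobolev constant vanishes.
  set G : ℝ := (C : ℝ) ^ s + 1 with hG
  have hG0 : 0 < G := by positivity
  refine ⟨G, hG0, fun v => ?_⟩
  set R : L2 Ω × L2vec Ω → ℝ := fun z => G * ‖z.2‖ ^ s * ‖z.1‖ ^ q with hR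
  have hRc : Continuous R := by
    refine (continuous_const.mul ?_).mul ?_
    · exact continuous_snd.norm.rpow_const fun _ => Or.inr hs0.le
    · exact continuous_fst.norm.rpow_const fun _ => Or.inr hq0.le
  have htest : ∀ z ∈ testPairs Ω, ∫⁻ x in Ω, ‖z.1 x‖ₑ ^ (p + 1) ≤ ENNReal.ofReal (R z) := by
    rintro z ⟨φ, h1, h2, h3, h4, h5⟩
    have n1 : eLpNorm φ 2 volume = ENNReal.ofReal ‖z.1‖ := by
      rw [Lp.norm_def, ENNReal.ofReal_toReal (Lp.eLpNorm_ne_top _), eLpNorm_congr_ae h4,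
        eLpNorm_restrict_eq_of_support_subset ((subset_tsupport φ).trans h3)]
    have n2 : eLpNorm (fderiv ℝ φ) 2 volume = ENNReal.ofReal ‖z.2‖ := by
      rw [Lp.norm_def, ENNReal.ofReal_toReal (Lp.eLpNorm_ne_top _), eLpNorm_congr_ae h5,
        eLpNorm_congr_enorm_ae (Eventually.of_forall (enorm_gradient φ))]
      refine (eLpNorm_restrict_eq_of_support_subset (f := fderiv ℝ φ) ?_).symm
      exact (support_fderiv_subset ℝ).trans h3
    calc ∫⁻ x in Ω, ‖z.1 x‖ₑ ^ (p + 1) = ∫⁻ x in Ω, ‖φ x‖ₑ ^ (p + 1) :=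
          lintegral_congr_ae (h4.mono fun x hx => by simp only [hx])
      _ ≤ ∫⁻ x, ‖φ x‖ₑ ^ (p + 1) := setLIntegral_le_lintegral _ _
      _ ≤ _ := hC φ h1 h2
      _ = ENNReal.ofReal ((C * ‖z.2‖) ^ s * ‖z.1‖ ^ q) := by
          rw [n1, n2, ENNReal.ofReal_mul (by positivity),
            ← ENNReal.ofReal_rpow_of_nonneg (by positivity) hs0.le,
            ← ENNReal.ofReal_rpow_of_nonneg (by positivity) hq0.le,
            ENNReal.ofReal_mul C.coe_nonneg, ENNReal.ofReal_coe_nnreal]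
      _ ≤ _ := by
          refine ENNReal.ofReal_le_ofReal ?_
          rw [Real.mul_rpow C.coe_nonneg (norm_nonneg _), hR]
          have : (C : ℝ) ^ s ≤ G := by rw [hG]; linarith
          dsimp only
          gcongr
  have hv : (v : L2 Ω × L2vec Ω) ∈ closure (testPairs Ω : Set (L2 Ω × L2vec Ω)) := v.2
  obtain ⟨z, hz, hlim⟩ := mem_closure_iff_seq_limit.1 hv
  have hlim1 : Tendsto (fun j => (z j).1) atTop (𝓝 (toL2 v)) := (continuous_fst.tendsto _).comp hlim
  -- Fatou needs pointwise limits: `L²` convergence provides them almost everywhere along a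
  -- subsequence.
  obtain ⟨ns, hns, hae⟩ := (tendstoInMeasure_of_tendsto_Lp hlim1).exists_seq_tendsto_ae
  have hRlim : Tendsto (fun j => ENNReal.ofReal (R (z (ns j)))) atTop (𝓝 (ENNReal.ofReal (R v))) :=
    (ENNReal.continuous_ofReal.tendsto _).comp
      (((hRc.tendsto _).comp hlim).comp hns.tendsto_atTop)
  calc ∫⁻ x in Ω, ‖toL2 v x‖ₑ ^ (p + 1)
      = ∫⁻ x in Ω, liminf (fun j => ‖(z (ns j)).1 x‖ₑ ^ (p + 1)) atTop := by
        refine lintegral_congr_ae (hae.mono fun x hx => ?_)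
        exact (((ENNReal.continuous_rpow_const.tendsto _).comp
          ((continuous_enorm.tendsto _).comp hx)).liminf_eq).symm
    _ ≤ liminf (fun j => ∫⁻ x in Ω, ‖(z (ns j)).1 x‖ₑ ^ (p + 1)) atTop :=
        lintegral_liminf_le' fun j => (Lp.aestronglyMeasurable _).enorm.pow_const _
    _ ≤ liminf (fun j => ENNReal.ofReal (R (z (ns j)))) atTop :=
        liminf_le_liminf (Eventually.of_forall fun j => htest _ (hz _))
    _ = ENNReal.ofReal (R v) := hRlim.liminf_eq

/-! ### Unbounded weights on `L²` as limits of bounded multipliers. -/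

section Weight

variable {X : Type*} [MeasurableSpace X] {μ : Measure X}

/-- Multiplication by an essentially bounded function on `L²`. -/
noncomputable def mulL2 {m : X → ℝ} (hm : MemLp m ⊤ μ) : Lp ℝ 2 μ →L[ℝ] Lp ℝ 2 μ :=
  (ContinuousLinearMap.mul ℝ ℝ).holderL μ ⊤ 2 2 hm.toLp

theorem coeFn_mulL2 {m : X → ℝ} (hm : MemLp m ⊤ μ) (f : Lp ℝ 2 μ) :
    mulL2 hm f =ᵐ[μ] fun x => m x * f x := by
  refine ((ContinuousLinearMap.mul ℝ ℝ).coeFn_holder (r := 2) hm.toLp f).trans ?_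
  filter_upwards [hm.coeFn_toLp] with x hx
  simp [hx]

theorem enorm_sq_eq_lintegral (f : Lp ℝ 2 μ) : ‖f‖ₑ ^ 2 = ∫⁻ x, ‖f x‖ₑ ^ 2 ∂μ := by
  rw [Lp.enorm_def, eLpNorm_eq_lintegral_rpow_enorm_toReal (by simp) (by simp), ← ENNReal.rpow_natCast,
    ← ENNReal.rpow_mul]
  simp

theorem memLp_two_of_lintegral_lt_top {f : X → ℝ} (hf : AEStronglyMeasurable f μ)
    (h : ∫⁻ x, ‖f x‖ₑ ^ 2 ∂μ < ⊤) : MemLp f 2 μ := by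
  refine ⟨hf, (eLpNorm_lt_top_iff_lintegral_rpow_enorm_lt_top (by simp) (by simp)).2 ?_⟩
  simpa using h

theorem memLp_top_min {g : X → ℝ} (hg : Measurable g) (hg0 : ∀ x, 0 ≤ g x) (j : ℕ) :
    MemLp (fun x => min (g x) j) ⊤ μ := by
  refine memLp_top_of_bound (hg.min measurable_const).aestronglyMeasurable j
    (Eventually.of_forall fun x => ?_)
  rw [Real.norm_of_nonneg (le_min (hg0 x) (Nat.cast_nonneg j))]
  exact min_le_right _ _

/-- Monotone convergence for the truncations `min g j`. Each truncation acts as a continuous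
operator, so this yields measurability in time of the weighted norm. -/
theorem lintegral_weight_eq_iSup {g : X → ℝ} (hg : Measurable g) (hg0 : ∀ x, 0 ≤ g x)
    (f : Lp ℝ 2 μ) :
    ∫⁻ x, ‖g x * f x‖ₑ ^ 2 ∂μ = ⨆ j : ℕ, ‖mulL2 (memLp_top_min (μ := μ) hg hg0 j) f‖ₑ ^ 2 := by
  have h1 : ∀ j : ℕ, ‖mulL2 (memLp_top_min (μ := μ) hg hg0 j) f‖ₑ ^ 2 =
      ∫⁻ x, ‖min (g x) j * f x‖ₑ ^ 2 ∂μ := fun j => by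
    rw [enorm_sq_eq_lintegral]
    exact lintegral_congr_ae ((coeFn_mulL2 (memLp_top_min (μ := μ) hg hg0 j) f).mono
      fun x hx => by simp only [hx])
  simp_rw [h1]
  have hmono : ∀ x, Monotone fun j : ℕ => ‖min (g x) j * f x‖ₑ ^ 2 := fun x i j hij => by
    dsimp only
    gcongr ?_ ^ 2
    rw [enorm_mul, enorm_mul]
    gcongr
    rw [Real.enorm_of_nonneg (le_min (hg0 x) (Nat.cast_nonneg _)),
      Real.enorm_of_nonneg (le_min (hg0 x) (Nat.cast_nonneg _))]
    gcongr
  rw [← lintegral_iSup' (fun j => ?_) (Eventually.of_forall hmono)]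
  · refine lintegral_congr fun x => ?_
    refine le_antisymm ?_ (iSup_le fun j => ?_)
    · obtain ⟨j, hj⟩ := exists_nat_ge (g x)
      refine le_iSup_of_le j ?_
      rw [min_eq_left hj]
    · gcongr ?_ ^ 2
      rw [enorm_mul, enorm_mul]
      gcongr
      rw [Real.enorm_of_nonneg (le_min (hg0 x) (Nat.cast_nonneg _)),
        Real.enorm_of_nonneg (hg0 x)]
      gcongr
      exact min_le_left _ _
  · exact (((hg.min measurable_const).aestronglyMeasurable.mul
      (Lp.aestronglyMeasurable f)).enorm.pow_const 2)

/-- Dominated convergence with majorant `|g f|²`. It exhibits the weighted function as a limit of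
strongly measurable ones. -/
theorem tendsto_mulL2_min {g : X → ℝ} (hg : Measurable g) (hg0 : ∀ x, 0 ≤ g x)
    {f F : Lp ℝ 2 μ} (hF : F =ᵐ[μ] fun x => g x * f x) :
    Tendsto (fun j : ℕ => mulL2 (memLp_top_min (μ := μ) hg hg0 j) f) atTop (𝓝 F) := by
  have hsq : ∀ j : ℕ, ‖mulL2 (memLp_top_min (μ := μ) hg hg0 j) f - F‖ₑ ^ 2 =
      ∫⁻ x, ‖min (g x) j * f x - g x * f x‖ₑ ^ 2 ∂μ := fun j => by
    rw [enorm_sq_eq_lintegral]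
    refine lintegral_congr_ae ?_
    filter_upwards [coeFn_mulL2 (memLp_top_min (μ := μ) hg hg0 j) f, hF,
      Lp.coeFn_sub (mulL2 (memLp_top_min (μ := μ) hg hg0 j) f) F] with x h1 h2 h3
    rw [h3, Pi.sub_apply, h1, h2]
  have hfin : ∫⁻ x, ‖g x * f x‖ₑ ^ 2 ∂μ ≠ ⊤ := by
    have : ∫⁻ x, ‖g x * f x‖ₑ ^ 2 ∂μ = ‖F‖ₑ ^ 2 := by
      rw [enorm_sq_eq_lintegral]
      exact lintegral_congr_ae (hF.mono fun x hx => by simp only [hx])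
    rw [this]
    exact ENNReal.pow_ne_top enorm_ne_top
  have hlim : Tendsto (fun j : ℕ => ‖mulL2 (memLp_top_min (μ := μ) hg hg0 j) f - F‖ₑ ^ 2)
      atTop (𝓝 0) := by
    simp_rw [hsq]
    have h0 : (0 : ℝ≥0∞) = ∫⁻ _, 0 ∂μ := by simp
    rw [h0]
    refine tendsto_lintegral_of_dominated_convergence' (fun x => ‖g x * f x‖ₑ ^ 2)
      (fun j => ?_) (fun j => Eventually.of_forall fun x => ?_) hfin
      (Eventually.of_forall fun x => ?_)
    · exact ((((hg.min measurable_const).aestronglyMeasurable.mul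
        (Lp.aestronglyMeasurable f)).sub
        (hg.aestronglyMeasurable.mul (Lp.aestronglyMeasurable f))).enorm.pow_const 2)
    · dsimp only
      gcongr ?_ ^ 2
      rw [← sub_mul, enorm_mul, enorm_mul]
      gcongr
      rw [enorm_le_iff_norm_le, Real.norm_eq_abs, Real.norm_of_nonneg (hg0 x), abs_le]
      have h1 : min (g x) j ≤ g x := min_le_left _ _
      have h2 : 0 ≤ min (g x) j := le_min (hg0 x) (Nat.cast_nonneg j)
      have h3 := hg0 x
      constructor <;> linarith
    · refine tendsto_const_nhds.congr' ?_
      obtain ⟨j, hj⟩ := exists_nat_ge (g x)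
      filter_upwards [eventually_ge_atTop j] with i hi
      have : g x ≤ i := hj.trans (by exact_mod_cast hi)
      simp [min_eq_left this]
  rw [tendsto_iff_edist_tendsto_0]
  have h2 := (ENNReal.continuous_rpow_const (y := 1 / 2)).tendsto 0 |>.comp hlim
  rw [ENNReal.zero_rpow_of_pos (by norm_num)] at h2
  refine h2.congr fun j => ?_
  rw [Function.comp_apply, edist_eq_enorm_sub, ← ENNReal.rpow_natCast, ← ENNReal.rpow_mul]
  norm_num

/-- A strongly measurable `L²`-valued map whose weighted `L²` norm is square integrable in time
has an integrable weighted version. -/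
theorem exists_integrable_weighted {α : Type*} [MeasurableSpace α] {ν : Measure α}
    [IsFiniteMeasure ν] {g : X → ℝ} (hg : Measurable g) (hg0 : ∀ x, 0 ≤ g x)
    {w : α → Lp ℝ 2 μ} (hw : AEStronglyMeasurable w ν)
    (hfin : ∫⁻ a, ∫⁻ x, ‖g x * w a x‖ₑ ^ 2 ∂μ ∂ν < ⊤) :
    ∃ W : α → Lp ℝ 2 μ, Integrable W ν ∧ ∀ᵐ a ∂ν, W a =ᵐ[μ] fun x => g x * w a x := by
  classical
  set M := fun j : ℕ => mulL2 (memLp_top_min (μ := μ) hg hg0 j) with hM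
  have hms : ∀ j, AEStronglyMeasurable (fun a => M j (w a)) ν := fun j =>
    (M j).continuous.comp_aestronglyMeasurable hw
  have hmeas : AEMeasurable (fun a => ∫⁻ x, ‖g x * w a x‖ₑ ^ 2 ∂μ) ν := by
    simp_rw [lintegral_weight_eq_iSup hg hg0]
    exact AEMeasurable.iSup fun j => (hms j).enorm.pow_const 2
  have hae : ∀ᵐ a ∂ν, MemLp (fun x => g x * w a x) 2 μ := by
    filter_upwards [ae_lt_top' hmeas hfin.ne] with a ha
    exact memLp_two_of_lintegral_lt_top
      (hg.aestronglyMeasurable.mul (Lp.aestronglyMeasurable _)) ha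
  -- The value `0` is used only on the null set of times where the weighted function is not in `L²`.
  set W : α → Lp ℝ 2 μ := fun a =>
    if h : MemLp (fun x => g x * w a x) 2 μ then h.toLp else 0 with hW
  have hWae : ∀ᵐ a ∂ν, W a =ᵐ[μ] fun x => g x * w a x := by
    filter_upwards [hae] with a ha
    simp only [hW, dif_pos ha]
    exact ha.coeFn_toLp
  have hWm : AEStronglyMeasurable W ν :=
    aestronglyMeasurable_of_tendsto_ae atTop hms
      (hWae.mono fun a ha => tendsto_mulL2_min hg hg0 ha)
  refine ⟨W, ?_, hWae⟩
  have h2 : MemLp W 2 ν := by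
    refine ⟨hWm, (eLpNorm_lt_top_iff_lintegral_rpow_enorm_lt_top (by simp) (by simp)).2 ?_⟩
    refine lt_of_le_of_lt (le_of_eq (lintegral_congr_ae ?_)) hfin
    filter_upwards [hWae] with a ha
    have : ‖W a‖ₑ ^ (2 : ℝ≥0∞).toReal = ‖W a‖ₑ ^ 2 := by simp
    rw [this, enorm_sq_eq_lintegral]
    exact lintegral_congr_ae (ha.mono fun x hx => by simp only [hx])
  exact h2.integrable one_le_two

end Weight

/-! ### The differential inequality along a weak solution. -/

section Solution

variable {n : ℕ} {Ω : Set (E n)}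

theorem _root_.MeasureTheory.L2.norm_sq_eq_integral {X F : Type*} [MeasurableSpace X]
    {μ : Measure X} [NormedAddCommGroup F] [InnerProductSpace ℝ F] (f : Lp F 2 μ) :
    ‖f‖ ^ 2 = ∫ x, inner ℝ (f x) (f x) ∂μ := by
  rw [← real_inner_self_eq_norm_sq, L2.inner_def]

theorem ae_ne_zero (hn : 3 ≤ n) (Ω : Set (E n)) : ∀ᵐ x ∂(volume.restrict Ω), x ≠ 0 := by
  have : Nonempty (Fin n) := ⟨⟨0, by omega⟩⟩
  exact ae_restrict_of_ae (compl_mem_ae_iff.2 (measure_singleton 0))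

theorem norm_le_diam (hb : Bornology.IsBounded Ω) (h0 : (0 : E n) ∈ Ω) {x : E n} (hx : x ∈ Ω) :
    ‖x‖ ≤ Metric.diam Ω := by
  simpa using Metric.dist_le_diam_of_mem hb hx h0

theorem memLp_top_norm (hΩ : MeasurableSet Ω) (hb : Bornology.IsBounded Ω) (h0 : (0 : E n) ∈ Ω) :
    MemLp (fun x : E n => ‖x‖) ⊤ (volume.restrict Ω) := by
  refine memLp_top_of_bound measurable_norm.aestronglyMeasurable (Metric.diam Ω) ?_
  filter_upwards [ae_restrict_mem hΩ] with x hx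
  simpa using norm_le_diam hb h0 hx

theorem integral_sq_div_eq_norm_sq (hn : 3 ≤ n) {f U : L2 Ω}
    (h : f =ᵐ[volume.restrict Ω] fun x => ‖x‖ * U x) :
    ∫ x in Ω, f x ^ 2 / ‖x‖ ^ 2 = ‖U‖ ^ 2 := by
  rw [L2.norm_sq_eq_integral]
  refine integral_congr_ae ?_
  filter_upwards [h, ae_ne_zero hn Ω] with x hx h0
  have : ‖x‖ ≠ 0 := norm_ne_zero_iff.2 h0
  rw [hx, real_inner_self_eq_norm_sq, Real.norm_eq_abs, sq_abs]
  field_simp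

theorem norm_le_diam_mul_norm (hΩ : MeasurableSet Ω) (hb : Bornology.IsBounded Ω)
    (h0 : (0 : E n) ∈ Ω) {f U : L2 Ω} (h : f =ᵐ[volume.restrict Ω] fun x => ‖x‖ * U x) :
    ‖f‖ ≤ Metric.diam Ω * ‖U‖ := by
  refine Lp.norm_le_mul_norm_of_ae_le_mul ?_
  filter_upwards [h, ae_restrict_mem hΩ] with x hx hm
  rw [hx, norm_mul, norm_norm]
  exact mul_le_mul_of_nonneg_right (norm_le_diam hb h0 hm) (norm_nonneg _)

/-- Since `|y|^{p-1} y · y = |y|^{p+1}` for either sign of `y`, testing the source with the solution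
gives exactly the quantity in (GN). -/
theorem integral_source_le {p G : ℝ} (hp : 1 < p) (hG : IsGNConstant Ω p G) (v : H10 Ω) :
    ∫ x in Ω, |toL2 v x| ^ (p - 1) * toL2 v x * toL2 v x ≤
      G * ‖grad v‖ ^ (alphaExp n p * (p + 1)) * ‖toL2 v‖ ^ ((1 - alphaExp n p) * (p + 1)) := by
  have e : ∀ y : ℝ, |y| ^ (p - 1) * y * y = |y| ^ (p + 1) := fun y => by
    have h1 : p + 1 = (p - 1) + 2 := by ring
    rw [h1, Real.rpow_add' (abs_nonneg y) (by linarith), Real.rpow_two, sq_abs]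
    ring
  simp_rw [e]
  rw [integral_eq_lintegral_of_nonneg_ae
    (Eventually.of_forall fun x => Real.rpow_nonneg (abs_nonneg _) _)
    (((Lp.aestronglyMeasurable (toL2 v)).norm.aemeasurable.pow_const _).aestronglyMeasurable)]
  have hG0 := hG.1
  refine ENNReal.toReal_le_of_le_ofReal (by positivity) (le_trans (le_of_eq ?_) (hG.2 v))
  refine lintegral_congr fun x => ?_
  rw [← ENNReal.ofReal_rpow_of_nonneg (abs_nonneg _) (by linarith), ← Real.norm_eq_abs,
    ofReal_norm]

theorem Cstar_nonneg (hn : 3 ≤ n) (Ω : Set (E n)) {p : ℝ} (hp : 1 < p)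
    (hp' : p < 1 + 4 / (n : ℝ)) {k₁ G : ℝ} (hk : 0 < k₁) (hG : 0 < G) : 0 ≤ Cstar Ω p k₁ G := by
  have := (Ctwo_pos hn hp hp' hk hG).le
  have := Metric.diam_nonneg (s := Ω)
  unfold Cstar
  positivity

/-- The differential inequality `L' ≤ C^* L ^ γ`, for a fixed time. -/
theorem source_sub_dirichlet_le (hn : 3 ≤ n) (hΩ : MeasurableSet Ω) (hb : Bornology.IsBounded Ω)
    (h0 : (0 : E n) ∈ Ω) {p : ℝ} (hp : 1 < p) (hp' : p < 1 + 4 / (n : ℝ)) {G : ℝ}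
    (hG : IsGNConstant Ω p G) {κ k₁ : ℝ} (hκ : 0 ≤ κ) (hκ₁ : κ ≤ k₁) (hk : 0 < k₁) (v : H10 Ω)
    {U : L2 Ω} (h : toL2 v =ᵐ[volume.restrict Ω] fun x => ‖x‖ * U x) :
    κ * (∫ x in Ω, |toL2 v x| ^ (p - 1) * toL2 v x * toL2 v x) -
        ∫ x in Ω, inner ℝ (grad v x) (grad v x) ≤
      Cstar Ω p k₁ G * (1 / 2 * ‖U‖ ^ 2) ^ gammaExp n p := by
  have hs2 := sobolevExp_lt_two hn hp hp'
  have hs0 := sobolevExp_pos hn hp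
  have hγ := one_lt_gammaExp hn hp hp'
  have hC2 := Ctwo_pos hn hp hp' hk hG.1
  have hG0 := hG.1
  have hd := Metric.diam_nonneg (s := Ω)
  have hS := integral_source_le hp hG v
  have eγ : (1 - alphaExp n p) * (p + 1) * (2 / (2 - alphaExp n p * (p + 1))) =
      2 * gammaExp n p := by unfold gammaExp; ring
  have hY := mul_rpow_mul_le_sq_add (mul_pos hk hG0) hs0 hs2 (norm_nonneg (grad v))
    (b := ‖toL2 v‖ ^ ((1 - alphaExp n p) * (p + 1))) (by positivity)
  rw [← Real.rpow_mul (norm_nonneg _), eγ] at hY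
  have hC : Ctwo n p k₁ G = k₁ * G * ((2 - alphaExp n p * (p + 1)) / 2) *
      (2 / (k₁ * G * (alphaExp n p * (p + 1)))) ^
        (-(alphaExp n p * (p + 1) / (2 - alphaExp n p * (p + 1)))) := rfl
  rw [← hC] at hY
  have hv : ‖toL2 v‖ ^ (2 * gammaExp n p) ≤ (Metric.diam Ω * ‖U‖) ^ (2 * gammaExp n p) :=
    Real.rpow_le_rpow (norm_nonneg _) (norm_le_diam_mul_norm hΩ hb h0 h) (by linarith)
  -- The factor `2^γ` in `C^*` cancels the `½` in `L`.
  have eC : Cstar Ω p k₁ G * (1 / 2 * ‖U‖ ^ 2) ^ gammaExp n p =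
      Ctwo n p k₁ G * (Metric.diam Ω * ‖U‖) ^ (2 * gammaExp n p) := by
    have h2 : (2 : ℝ) ^ gammaExp n p ≠ 0 := (Real.rpow_pos_of_pos two_pos _).ne'
    rw [Cstar, Real.mul_rpow hd (norm_nonneg _), Real.mul_rpow (by norm_num) (sq_nonneg _),
      one_div, Real.inv_rpow two_pos.le, Real.rpow_mul (norm_nonneg U) 2, Real.rpow_two]
    field_simp
  rw [← L2.norm_sq_eq_integral, eC]
  have h3 := mul_le_mul_of_nonneg_left hv hC2.le
  have h4 := mul_le_mul_of_nonneg_left hS hκ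
  have h5 : κ * (G * ‖grad v‖ ^ (alphaExp n p * (p + 1)) *
      ‖toL2 v‖ ^ ((1 - alphaExp n p) * (p + 1))) ≤
      k₁ * (G * ‖grad v‖ ^ (alphaExp n p * (p + 1)) *
      ‖toL2 v‖ ^ ((1 - alphaExp n p) * (p + 1))) :=
    mul_le_mul_of_nonneg_right hκ₁ (by positivity)
  linarith

/-- If `u(t)/|x|` is square integrable at one time, then `u/|x|` is a primitive of an integrable
`L²`-valued function. -/
theorem IsWeakSolution.exists_primitive (hn : 3 ≤ n) (hΩ : MeasurableSet Ω)
    (hb : Bornology.IsBounded Ω) (h0 : (0 : E n) ∈ Ω) {p : ℝ} {k : ℝ → ℝ} {u₀ : H10 Ω} {T : ℝ}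
    {u : ℝ → H10 Ω} (hu : IsWeakSolution Ω p k u₀ T u) {t₁ : ℝ} (ht₁ : t₁ ∈ Ioo 0 T)
    (hne : ∫ x in Ω, (toL2 (u t₁) x) ^ 2 / ‖x‖ ^ 2 ≠ 0) :
    ∃ (W : ℝ → L2 Ω) (U₀ : L2 Ω), Integrable W ∧
      (∀ t ∈ Ico 0 T, toL2 (u t) =ᵐ[volume.restrict Ω]
        fun x => ‖x‖ * (U₀ + ∫ s in (0 : ℝ)..t, W s : L2 Ω) x) ∧
      ∀ᵐ t ∂(volume.restrict (Ioo 0 T)), ∀ (v : H10 Ω) (V : L2 Ω),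
        toL2 v =ᵐ[volume.restrict Ω] (fun x => ‖x‖ * V x) →
        inner ℝ V (W t) = k t * (∫ x in Ω, |toL2 (u t) x| ^ (p - 1) * toL2 (u t) x * toL2 v x) -
          ∫ x in Ω, inner ℝ (grad (u t) x) (grad v x) := by
  obtain ⟨-, hu0, w, hwm, hwfin, hwint, hweq⟩ := hu
  have hgm : Measurable fun x : E n => ‖x‖⁻¹ := measurable_norm.inv
  have hdiv : ∀ t x, w t x / ‖x‖ = ‖x‖⁻¹ * w t x := fun t x => by rw [div_eq_inv_mul]
  simp_rw [hdiv] at hwfin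
  obtain ⟨W', hW'i, hW'⟩ := exists_integrable_weighted hgm (fun x => by positivity) hwm hwfin
  -- Multiplication by `|x|`, bounded because `Ω` is; being continuous and linear it commutes with
  -- the time integral, and it undoes division by `|x|`.
  set A := mulL2 (memLp_top_norm hΩ hb h0) with hA
  have hAW : ∀ (f V : L2 Ω), (V =ᵐ[volume.restrict Ω] fun x => ‖x‖⁻¹ * f x) → A V = f := by
    intro f V hV
    refine Lp.ext ?_
    filter_upwards [coeFn_mulL2 (memLp_top_norm hΩ hb h0) V, hV, ae_ne_zero hn Ω] with x h1 h2 h3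
    have : ‖x‖ ≠ 0 := norm_ne_zero_iff.2 h3
    rw [hA, h1, h2, mul_inv_cancel_left₀ this]
  set W : ℝ → L2 Ω := (Ioo 0 T).indicator W' with hWdef
  have hWi : Integrable W := (integrable_indicator_iff measurableSet_Ioo).2 hW'i
  have hWW' : ∀ t ∈ Ioo 0 T, W t = W' t := fun t ht => indicator_of_mem ht _
  have hint : ∀ t ∈ Ico 0 T, ∫ s in (0 : ℝ)..t, w s = A (∫ s in (0 : ℝ)..t, W s) := by
    intro t ht
    rw [← A.intervalIntegral_comp_comm hWi.intervalIntegrable]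
    refine intervalIntegral.integral_congr_ae ?_
    filter_upwards [(ae_restrict_iff' measurableSet_Ioo).1 hW'] with s hs hst
    rw [uIoc_of_le ht.1] at hst
    have hsT : s ∈ Ioo 0 T := ⟨hst.1, hst.2.trans_lt ht.2⟩
    rw [hWW' s hsT, hAW _ _ (hs hsT)]
  -- The integral of a non-integrable function is `0` by convention, so a nonzero value certifies
  -- `u(t₁)/|x| ∈ L²`.
  have hmem : MemLp (fun x => ‖x‖⁻¹ * toL2 (u t₁) x) 2 (volume.restrict Ω) := by
    refine (memLp_two_iff_integrable_sq
      (hgm.aestronglyMeasurable.mul (Lp.aestronglyMeasurable (toL2 (u t₁))))).2 ?_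
    refine (not_imp_comm.1 integral_undef hne).congr (Eventually.of_forall fun x => ?_)
    simp only [Pi.mul_apply]
    rw [← div_eq_inv_mul, div_pow]
  -- The value of `u/|x|` at time `0`, recovered by integrating back from `t₁`.
  set U₀ : L2 Ω := hmem.toLp - ∫ s in (0 : ℝ)..t₁, W s with hU₀
  have hAU₀ : A U₀ = toL2 u₀ := by
    have ht₁' : t₁ ∈ Ico 0 T := ⟨ht₁.1.le, ht₁.2⟩
    rw [hU₀, map_sub, hAW _ _ hmem.coeFn_toLp, ← hint t₁ ht₁', hwint t₁ ht₁', add_sub_cancel_right]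
  refine ⟨W, U₀, hWi, fun t ht => ?_, ?_⟩
  · have : toL2 (u t) = A (U₀ + ∫ s in (0 : ℝ)..t, W s) := by
      rw [map_add, hAU₀, ← hint t ht, hwint t ht]
    rw [this]
    exact coeFn_mulL2 _ _
  · filter_upwards [hW', hweq, ae_restrict_mem measurableSet_Ioo] with t h1 h2 h3 v V hV
    rw [← h2 v, add_sub_cancel_right, hWW' t h3, L2.inner_def]
    refine integral_congr_ae ?_
    filter_upwards [h1, hV, ae_ne_zero hn Ω] with x hx1 hx2 hx3
    have : ‖x‖ ≠ 0 := norm_ne_zero_iff.2 hx3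
    rw [hx1, hx2]
    simp only [RCLike.inner_apply, conj_trivial]
    field_simp

theorem AssumptionA.monotoneOn {k : ℝ → ℝ} (hk : AssumptionA k) : MonotoneOn k (Ici 0) :=
  monotoneOn_of_deriv_nonneg (convex_Ici 0) hk.contDiffOn.continuousOn
    ((hk.contDiffOn.differentiableOn (by simp)).mono interior_subset) fun x hx => by
      rw [← derivWithin_of_mem_nhds (s := Ici 0) (mem_interior_iff_mem_nhds.1 hx)]
      exact hk.deriv_nonneg x (interior_subset hx)

/-- A lower bound for the growth of the Hardy energy of a weak solution. -/
theorem IsWeakSolution.halfHardy_rpow_sub_le (hn : 3 ≤ n) (hΩ : MeasurableSet Ω)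
    (hb : Bornology.IsBounded Ω) (h0 : (0 : E n) ∈ Ω) {p : ℝ} (hp : 1 < p)
    (hp' : p < 1 + 4 / (n : ℝ)) {G : ℝ} (hG : IsGNConstant Ω p G) {k : ℝ → ℝ} {k₁ : ℝ}
    {u₀ : H10 Ω} {T : ℝ} {u : ℝ → H10 Ω} (hu : IsWeakSolution Ω p k u₀ T u)
    (hk : ∀ t ∈ Ioo 0 T, 0 ≤ k t ∧ k t ≤ k₁) (hk₁ : 0 < k₁) (hu₀ : toL2 u₀ ≠ 0)
    {t : ℝ} (ht : t ∈ Ioo 0 T) (hpos : 0 < halfHardy (u t)) :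
    0 < Metric.diam Ω ∧ 0 < halfHardy (u 0) ∧
    halfHardy (u 0) ^ (1 - gammaExp n p) - Cstar Ω p k₁ G * (gammaExp n p - 1) * t ≤
      halfHardy (u t) ^ (1 - gammaExp n p) := by
  have hne : ∫ x in Ω, (toL2 (u t) x) ^ 2 / ‖x‖ ^ 2 ≠ 0 := fun h => by
    simp [halfHardy, h] at hpos
  obtain ⟨W, U₀, hWi, hU, hW⟩ := hu.exists_primitive hn hΩ hb h0 ht hne
  set U : ℝ → L2 Ω := fun t => U₀ + ∫ s in (0 : ℝ)..t, W s with hUdef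
  set f : ℝ → ℝ := fun t => 1 / 2 * ‖U t‖ ^ 2 with hf
  have hfu : ∀ s ∈ Ico 0 T, halfHardy (u s) = f s := fun s hs => by
    rw [halfHardy, integral_sq_div_eq_norm_sq hn (hU s hs)]
  have h0T : (0 : ℝ) ∈ Ico 0 T := ⟨le_rfl, ht.1.trans ht.2⟩
  -- As `u₀ ≠ 0`, the bound `‖u₀‖₂ ≤ diam Ω · ‖U 0‖` forces both factors to be positive.
  have hnorm := norm_le_diam_mul_norm hΩ hb h0 (hU 0 h0T)
  rw [hu.2.1] at hnorm
  have hpos0 : 0 < Metric.diam Ω * ‖U 0‖ := (norm_pos_iff.2 hu₀).trans_le hnorm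
  have hdiam : 0 < Metric.diam Ω := pos_of_mul_pos_left hpos0 (norm_nonneg _)
  have hU0 : 0 < ‖U 0‖ := pos_of_mul_pos_right hpos0 hdiam.le
  have hf0 : 0 < f 0 := by simp only [hf]; positivity
  have hUc : Continuous U := continuous_const.add
    (intervalIntegral.continuous_primitive (fun a b => hWi.intervalIntegrable) 0)
  have hfc : Continuous f := continuous_const.mul (hUc.norm.pow 2)
  have hγ := one_lt_gammaExp hn hp hp'
  have hC := Cstar_nonneg hn Ω hp hp' hk₁ hG.1
  have ht' : t ∈ Ico 0 T := ⟨ht.1.le, ht.2⟩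
  refine ⟨hdiam, hfu 0 h0T ▸ hf0, ?_⟩
  rw [hfu 0 h0T, hfu t ht']
  rw [hfu t ht'] at hpos
  refine rpow_sub_le_rpow_of_le_integral (T := t) hfc (fun s => by simp only [hf]; positivity) hf0
    hC hγ (fun s hs => ?_) (right_mem_Icc.2 ht.1.le) hpos
  obtain ⟨hI, hE⟩ := half_norm_sq_primitive hWi U₀ s
  have hE' : f s = f 0 + ∫ r in (0 : ℝ)..s, inner ℝ (U r) (W r) := hE
  rw [hE']
  refine add_le_add le_rfl ?_
  have hc : Continuous fun r => Cstar Ω p k₁ G * f r ^ gammaExp n p :=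
    continuous_const.mul (hfc.rpow_const fun x => Or.inr (by linarith))
  refine intervalIntegral.integral_mono_ae_restrict hs.1 hI (hc.intervalIntegrable _ _) ?_
  refine (ae_restrict_iff' measurableSet_Icc).2 ?_
  filter_upwards [(ae_restrict_iff' measurableSet_Ioo).1 hW,
    compl_mem_ae_iff.2 (measure_singleton (0 : ℝ))] with r hr hr0 hrs
  have hrT : r ∈ Ioo 0 T :=
    ⟨lt_of_le_of_ne hrs.1 (Ne.symm hr0), (hrs.2.trans hs.2).trans_lt ht.2⟩
  have hUr := hU r ⟨hrT.1.le, hrT.2⟩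
  -- The weak equation at time `r`, tested with `u r` itself.
  rw [hr hrT (u r) (U r) hUr]
  exact source_sub_dirichlet_le hn hΩ hb h0 hp hp' hG (hk r hrT).1 (hk r hrT).2 hk₁ (u r) hUr

end Solution

end RD

/-! ### Passage to the blow-up time. -/

theorem theorem4p1 (n : ℕ) (hn : 3 ≤ n) (Ω : Set (RD.E n)) (hΩ_open : IsOpen Ω)
    (hΩ_conn : IsConnected Ω) (hΩ_bdd : Bornology.IsBounded Ω) (hΩ_zero : (0 : RD.E n) ∈ Ω)
    (p : ℝ) (hp_one : 1 < p) (hp : p < 1 + 4 / (n : ℝ)) :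
    1 < RD.gammaExp n p ∧
    (∃ G : ℝ, RD.IsGNConstant Ω p G) ∧
    ∀ G : ℝ, RD.IsGNConstant Ω p G →
    ∀ k : ℝ → ℝ, RD.AssumptionA k →
    ∀ u₀ : RD.H10 Ω, 0 ≤ᵐ[volume.restrict Ω] (RD.toL2 u₀ : RD.E n → ℝ) → RD.toL2 u₀ ≠ 0 →
    ∀ (Tstar : ℝ) (u : ℝ → RD.H10 Ω), RD.BlowsUpAt Ω p k u₀ Tstar u →
    ∀ k₁ : ℝ, k Tstar ≤ k₁ →
      0 < RD.halfHardy (u 0) ∧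
      0 < RD.Cstar Ω p k₁ G ∧
      RD.halfHardy (u 0) ^ (1 - RD.gammaExp n p) /
        (RD.Cstar Ω p k₁ G * (RD.gammaExp n p - 1)) ≤ Tstar := by
  have hγ := RD.one_lt_gammaExp hn hp_one hp
  refine ⟨hγ, RD.exists_isGNConstant hn Ω hp_one hp, ?_⟩
  rintro G hG k hk u₀ - hu₀ Tstar u ⟨hT0, hsol, hblow⟩ k₁ hk₁
  have hmono := hk.monotoneOn
  have hk₁pos : 0 < k₁ :=
    (hk.pos.trans_le (hmono (self_mem_Ici) hT0.le hT0.le)).trans_le hk₁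
  have hkb : ∀ t ∈ Ioo 0 Tstar, 0 ≤ k t ∧ k t ≤ k₁ := fun t ht =>
    ⟨hk.pos.le.trans (hmono self_mem_Ici ht.1.le ht.1.le),
      (hmono ht.1.le hT0.le ht.2.le).trans hk₁⟩
  have hlim : Tendsto (fun t => RD.halfHardy (u t)) (𝓝[<] Tstar) atTop :=
    hblow.const_mul_atTop (by norm_num)
  -- Positivity near `Tstar` supplies the times at which `u/|x|` is known to be in `L²`.
  have hev : ∀ᶠ t in 𝓝[<] Tstar, t ∈ Ioo 0 Tstar ∧ 0 < RD.halfHardy (u t) :=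
    Eventually.and (Ioo_mem_nhdsLT hT0) (hlim.eventually_gt_atTop 0)
  have key := hev.mono fun t ht => by
    obtain ⟨T, hT1, hT2⟩ := exists_between ht.1.2
    exact (hsol T ⟨ht.1.1.trans hT1, hT2⟩).halfHardy_rpow_sub_le hn hΩ_open.measurableSet hΩ_bdd
      hΩ_zero hp_one hp hG (fun s hs => hkb s ⟨hs.1, hs.2.trans hT2⟩) hk₁pos hu₀ ⟨ht.1.1, hT1⟩ ht.2
  obtain ⟨t, hdiam, hL0, -⟩ := key.exists
  have hC : 0 < RD.Cstar Ω p k₁ G := by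
    have := RD.Ctwo_pos hn hp_one hp hk₁pos hG.1
    unfold RD.Cstar
    positivity
  refine ⟨hL0, hC, ?_⟩
  have hdecay : Tendsto (fun t => RD.halfHardy (u t) ^ (1 - RD.gammaExp n p)) (𝓝[<] Tstar)
      (𝓝 0) := by
    have := (tendsto_rpow_neg_atTop (sub_pos.2 hγ)).comp hlim
    rwa [neg_sub] at this
  have hleft : Tendsto (fun t => RD.halfHardy (u 0) ^ (1 - RD.gammaExp n p) -
      RD.Cstar Ω p k₁ G * (RD.gammaExp n p - 1) * t) (𝓝[<] Tstar)
      (𝓝 (RD.halfHardy (u 0) ^ (1 - RD.gammaExp n p) -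
        RD.Cstar Ω p k₁ G * (RD.gammaExp n p - 1) * Tstar)) :=
    ((by fun_prop : Continuous fun t : ℝ => RD.halfHardy (u 0) ^ (1 - RD.gammaExp n p) -
      RD.Cstar Ω p k₁ G * (RD.gammaExp n p - 1) * t).tendsto Tstar).mono_left nhdsWithin_le_nhds
  have := le_of_tendsto_of_tendsto hleft hdecay (key.mono fun t ht => ht.2.2)
  rw [div_le_iff₀ (mul_pos hC (sub_pos.2 hγ))]
  linarith
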